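/- Let the Euclidean plane $\mathbb{R}^2$ be coloured with two colours so that both colour classes are Lebesgue measurable, and let $\ell>0$. Every isosceles right triangle with legs of length $\ell$ has vertices $x,\ x+\ell(\cos\theta,\sin\theta),\ x+\ell(-\sin\theta,\cos\theta)$ for exactly one point $x\in\mathbb{R}^2$ (the vertex of the right angle) and one angle $\theta\in[0,2\pi)$. For $T>0$ let $M_\ell(T)$ be the set of all $(x,\theta)\in[-T,T]^2\times[0,2\pi)$ for which the three vertices of this triangle have the same colour. Then the measure (lower density) of the monochromatic isosceles right triangles with legs of length $\ell$ is at least $0.0079$: $$\liminf_{T\to\infty}\ \frac{1}{2\pi\,(2T)^2}\,\bigl|M_\ell(T)\bigr|\ \ge\ 0.0079,$$ where $|\cdot|$ denotes Lebesgue measure on $\mathbb{R}^2\times\mathbb{R}$. -/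

import Mathlib

open MeasureTheory Filter
open scoped ENNReal

noncomputable section

namespace MonoTriangle

/-- The Euclidean plane. -/
abbrev Plane : Type := EuclideanSpace ℝ (Fin 2)

/-- The unit vector with polar angle `θ`. -/
def dir (θ : ℝ) : Plane := !₂[Real.cos θ, Real.sin θ]

/-- Rotation of a vector by a quarter turn, `(y₁, y₂) ↦ (-y₂, y₁)`. -/
def perp (y : Plane) : Plane := !₂[-(y 1), y 0]

/-- The isosceles right triangles with legs of length `l > 0` are the triples
`x, x + y, x + y^⊥` with `y = l • dir θ`; each of them arises from exactly one pair of a point `x`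
(the vertex of the right angle) and an angle `θ ∈ [0, 2π)`. This says that the triangle given by
`(x, θ)` is monochromatic for the colouring `c`. -/
def IsMono (c : Plane → Fin 2) (l : ℝ) (x : Plane) (θ : ℝ) : Prop :=
  c x = c (x + l • dir θ) ∧ c x = c (x + perp (l • dir θ))

/-- The square `[-T, T]²`. -/
def box (T : ℝ) : Set Plane := {x | ∀ i, x i ∈ Set.Icc (-T) T}

/-- All isosceles right triangles with legs of length `l` (for any `l`)
whose right angle is at a point of `[-T, T]²`, as pairs `(x, θ)`. -/
def triangles (T : ℝ) : Set (Plane × ℝ) := box T ×ˢ Set.Ico 0 (2 * Real.pi)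

/-- The monochromatic ones among them. -/
def monoTriangles (c : Plane → Fin 2) (l T : ℝ) : Set (Plane × ℝ) :=
  {p ∈ triangles T | IsMono c l p.1 p.2}

/-- The measure of the monochromatic isosceles right triangles with legs of length `l`: their lower
density among all isosceles right triangles with legs of length `l`, with respect to the
isometry-invariant measure `dx dθ`. -/
def monoMeasure (c : Plane → Fin 2) (l : ℝ) : ℝ≥0∞ :=
  liminf (fun T : ℝ => volume (monoTriangles c l T) / volume (triangles T)) atTop

end MonoTriangle

end

noncomputable section

namespace MonoTriangle

/-! Let f = ±1 encode the colouring. The sum of the products of f over the three sides of a triangle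
is 3 if it is monochromatic and -1 otherwise, so the mean of that sum is 4p - 1, with p the
monochromatic density. Averaging over position and angle turns each side into a mean autocorrelation
of f on a circle: twice radius l, once radius √2 l. On the Fourier side (`circleCorr_schwartz`) the
circle of radius r becomes the multiplier J₀(2πr|ξ|) against the positive weight |f̂|². So p is
bounded below once 2J₀(t) + J₀(√2 t) ≥ -0.9684 for all t ≥ 0 (`bessel_lower_bound`), and 1 - 0.9684
= 4 · 0.0079.

To have a square integrable function, f is cut off to a box (`integral_sideSum_ge`); the boundary
costs O(lT) against area 4T² (`sideSum_le`) and vanishes in the limit. -/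

/-! ### Taylor bounds and a polynomial inequality -/

open Finset in
/-- Alternating Taylor bounds for `cos` and `sin` on the half-line. -/
theorem taylor_alternating (n : ℕ) : ∀ x : ℝ, 0 ≤ x →
    0 ≤ (-1) ^ (n + 1) *
      (Real.cos x - ∑ k ∈ range (n + 1), (-1) ^ k * (x ^ (2 * k) / (2 * k).factorial))
    ∧ 0 ≤ (-1) ^ (n + 1) *
      (Real.sin x - ∑ k ∈ range (n + 1), (-1) ^ k * (x ^ (2 * k + 1) / (2 * k + 1).factorial)) := by
  have nonneg_of_deriv : ∀ f f' : ℝ → ℝ, f 0 = 0 → (∀ x, HasDerivAt f (f' x) x) →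
      (∀ x, 0 ≤ x → 0 ≤ f' x) → ∀ x, 0 ≤ x → 0 ≤ f x := by
    intro f f' h0 hd hf' x hx
    have hm : MonotoneOn f (Set.Ici 0) := by
      refine monotoneOn_of_deriv_nonneg (convex_Ici 0)
        (fun y _ => (hd y).continuousAt.continuousWithinAt)
        (fun y _ => (hd y).differentiableAt.differentiableWithinAt) fun y hy => ?_
      rw [(hd y).deriv]
      exact hf' y (interior_subset hy)
    simpa [h0] using hm (Set.mem_Ici.2 le_rfl) (Set.mem_Ici.2 hx) hx
  have hpow : ∀ (m : ℕ) (x : ℝ), HasDerivAt (fun x : ℝ => x ^ (m + 1) / (m + 1).factorial)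
      (x ^ m / m.factorial) x := by
    intro m x
    have h := (hasDerivAt_pow (m + 1) x).div_const ((m + 1).factorial : ℝ)
    convert! h using 1
    rw [Nat.factorial_succ]
    push_cast
    field_simp
  have sin_of_cos : ∀ n : ℕ, (∀ x : ℝ, 0 ≤ x → 0 ≤ (-1) ^ (n + 1) *
      (Real.cos x - ∑ k ∈ range (n + 1), (-1) ^ k * (x ^ (2 * k) / (2 * k).factorial))) →
      ∀ x : ℝ, 0 ≤ x → 0 ≤ (-1) ^ (n + 1) * (Real.sin x -
        ∑ k ∈ range (n + 1), (-1) ^ k * (x ^ (2 * k + 1) / (2 * k + 1).factorial)) := by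
    intro n h
    refine nonneg_of_deriv _ _ (by simp) (fun x => ?_) h
    exact ((Real.hasDerivAt_sin x).sub (HasDerivAt.fun_sum fun k _ =>
      (hpow (2 * k) x).const_mul ((-1 : ℝ) ^ k))).const_mul _
  -- The derivative of a sine remainder is the cosine remainder of the same order; that of the next
  -- cosine remainder is, with its sign, this sine remainder.
  induction n with
  | zero =>
    have hc : ∀ x : ℝ, 0 ≤ x → 0 ≤ (-1) ^ (0 + 1) *
      (Real.cos x - ∑ k ∈ range (0 + 1), (-1) ^ k * (x ^ (2 * k) / (2 * k).factorial)) := by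
      intro x _
      simpa using Real.cos_le_one x
    exact fun x hx => ⟨hc x hx, sin_of_cos 0 hc x hx⟩
  | succ n ih =>
    have hc : ∀ x : ℝ, 0 ≤ x → 0 ≤ (-1) ^ (n + 1 + 1) *
        (Real.cos x - ∑ k ∈ range (n + 1 + 1), (-1) ^ k * (x ^ (2 * k) / (2 * k).factorial)) := by
      refine nonneg_of_deriv _ _ ?_ (fun x => ?_) (fun x hx => (ih x hx).2)
      · rw [sum_range_succ']; simp
      · have h := ((Real.hasDerivAt_cos x).sub ((HasDerivAt.fun_sum (u := range (n + 1)) fun k _ =>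
          (hpow (2 * k + 1) x).const_mul ((-1 : ℝ) ^ (k + 1))).add_const (1 : ℝ))).const_mul
            ((-1 : ℝ) ^ (n + 1 + 1))
        convert! h using 1
        · funext y
          rw [sum_range_succ' _ (n + 1)]
          simp [mul_add]
        · simp only [pow_succ, mul_sub, mul_sum]
          ring_nf
    exact fun x hx => ⟨hc x hx, sin_of_cos (n + 1) hc x hx⟩

/-- A polynomial minorant of `s ↦ 0.9684 + 2 J₀(t) + J₀(√2 t)`, `s = t² / 4`, is nonnegative on
`[0, 9]`: on three subintervals its Bernstein coefficients are positive. -/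
theorem minorant_nonneg {s : ℝ} (h0 : 0 ≤ s) (h9 : s ≤ 9) :
    0 ≤ 9921 / 2500 - 4 * s + 3 / 2 * s ^ 2 - 5 / 18 * s ^ 3 +
      1 / 32 * s ^ 4 - 17 / 7200 * s ^ 5 + 11 / 86400 * s ^ 6 -
      13 / 2540160 * s ^ 7 + 43 / 270950400 * s ^ 8 - 257 / 65840947200 * s ^ 9 := by
  -- On the short middle interval the polynomial nearly vanishes (it is below 0.001 at both ends).
  -- Each expansion is homogeneous of degree 9 in u and v, the distances to the endpoints.
  rcases le_total s (11 / 4) with h1 | h1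
  on_goal 2 => rcases le_total s (17 / 6) with h2 | h2
  · obtain ⟨u, hu⟩ : ∃ u, u = s - 0 := ⟨_, rfl⟩
    obtain ⟨v, hv⟩ : ∃ v, v = 11 / 4 - s := ⟨_, rfl⟩
    have hu0 : 0 ≤ u := by linarith
    have hv0 : 0 ≤ v := by linarith
    calc (0 : ℝ) ≤ 650182656 / 1473717306875 * v ^ 9 +
        4049403904 / 1473717306875 * u * v ^ 8 +
        10847215616 / 1473717306875 * u ^ 2 * v ^ 7 +
        145944487936 / 13263455761875 * u ^ 3 * v ^ 6 +
        43923663968 / 4421151920625 * u ^ 4 * v ^ 5 +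
        72195658504 / 13263455761875 * u ^ 5 * v ^ 4 +
        135193385291 / 79580734571250 * u ^ 6 * v ^ 3 +
        11605405296257 / 46793471927895000 * u ^ 7 * v ^ 2 +
        86166726106873 / 11979128813541120000 * u ^ 8 * v +
        253090952192753 / 3881237735587322880000 * u ^ 9 := by positivity
      _ = _ := by rw [hu, hv]; ring
  · obtain ⟨u, hu⟩ : ∃ u, u = s - 11 / 4 := ⟨_, rfl⟩
    obtain ⟨v, hv⟩ : ∃ v, v = 17 / 6 - s := ⟨_, rfl⟩
    have hu0 : 0 ≤ u := by linarith
    have hv0 : 0 ≤ v := by linarith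
    calc (0 : ℝ) ≤ 759272856578259 / 250880000 * v ^ 9 +
        2251264186925253 / 125440000 * u * v ^ 8 +
        671751130337439 / 15680000 * u ^ 2 * v ^ 7 +
        172672059617657 / 3360000 * u ^ 3 * v ^ 6 +
        108784016849273 / 3360000 * u ^ 4 * v ^ 5 +
        11169685424771 / 720000 * u ^ 5 * v ^ 4 +
        28293424385819 / 1620000 * u ^ 6 * v ^ 3 +
        727248221855537 / 39690000 * u ^ 7 * v ^ 2 +
        2194618214996993 / 238140000 * u ^ 8 * v +
        5627822653228877 / 3214890000 * u ^ 9 := by positivity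
      _ = _ := by rw [hu, hv]; ring
  · obtain ⟨u, hu⟩ : ∃ u, u = s - 17 / 6 := ⟨_, rfl⟩
    obtain ⟨v, hv⟩ : ∃ v, v = 9 - s := ⟨_, rfl⟩
    have hu0 : 0 ≤ u := by linarith
    have hv0 : 0 ≤ v := by linarith
    calc (0 : ℝ) ≤ 5627822653228877 / 213920101196695089423360000 * v ^ 9 +
        206578792971643 / 27510301079821899360000 * u * v ^ 8 +
        12581896562328923 / 18340200719881266240000 * u ^ 2 * v ^ 7 +
        247896367590931 / 72778574285243120000 * u ^ 3 * v ^ 6 +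
        1096559271136593 / 145557148570486240000 * u ^ 4 * v ^ 5 +
        171919791436221 / 18194643571310780000 * u ^ 5 * v ^ 4 +
        131393158954389 / 18194643571310780000 * u ^ 6 * v ^ 3 +
        106392514933323 / 31840626249793865000 * u ^ 7 * v ^ 2 +
        108325892370573 / 127362504999175460000 * u ^ 8 * v +
        666514583667 / 7960156562448466250 * u ^ 9 := by positivity
      _ = _ := by rw [hu, hv]; ring

/-! ### Bessel functions -/

open Finset in
theorem cos_taylor_alternating (n : ℕ) (x : ℝ) :
    0 ≤ (-1) ^ (n + 1) * (Real.cos x - ∑ k ∈ range (n + 1),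
      (-1) ^ k * (x ^ (2 * k) / (2 * k).factorial)) := by
  simpa [pow_mul] using (taylor_alternating n |x| (abs_nonneg x)).1

open Finset in
-- The factor x makes the function even, so the bound survives for negative x; this matters because
-- t cos θ changes sign.
theorem mul_sin_taylor_alternating (n : ℕ) (x : ℝ) :
    0 ≤ (-1) ^ (n + 1) * (x * Real.sin x - ∑ k ∈ range (n + 1),
      (-1) ^ k * (x ^ (2 * k + 2) / (2 * k + 1).factorial)) := by
  have key : ∀ y : ℝ, 0 ≤ y → 0 ≤ (-1) ^ (n + 1) * (y * Real.sin y - ∑ k ∈ range (n + 1),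
      (-1) ^ k * (y ^ (2 * k + 2) / (2 * k + 1).factorial)) := by
    intro y hy
    convert! mul_nonneg hy (taylor_alternating n y hy).2 using 1
    rw [mul_left_comm y]
    congr 1
    rw [mul_sub, mul_sum]
    congr 1
    exact sum_congr rfl fun k _ => by ring
  rcases le_total 0 x with hx | hx
  · exact key x hx
  · have := key (-x) (by linarith)
    have he : ∀ k : ℕ, Even (2 * k + 2) := fun k => ⟨k + 1, by ring⟩
    simpa [(he _).neg_pow] using this

/-- The Bessel function `J₀`. -/
def besselJZero (t : ℝ) : ℝ :=
  (2 * Real.pi)⁻¹ * ∫ θ in (0 : ℝ)..(2 * Real.pi), Real.cos (t * Real.cos θ)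

/-- The Bessel function `J₁ = -J₀'`. -/
def besselJOne (t : ℝ) : ℝ :=
  (2 * Real.pi)⁻¹ * ∫ θ in (0 : ℝ)..(2 * Real.pi), Real.cos θ * Real.sin (t * Real.cos θ)

theorem integral_cos_pow_two_mul (k : ℕ) :
    ∫ θ in (0 : ℝ)..(2 * Real.pi), Real.cos θ ^ (2 * k) =
      2 * Real.pi * ((2 * k).factorial / (4 ^ k * (k.factorial : ℝ) ^ 2)) := by
  induction k with
  | zero => simp
  | succ k ih =>
    rw [mul_add, mul_one, integral_cos_pow, ih]
    have : (2 * k + 2).factorial = (2 * k + 2) * ((2 * k + 1) * (2 * k).factorial) := rfl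
    rw [this, Nat.factorial_succ]
    push_cast
    simp
    field_simp
    ring

theorem mean_mul_cos_pow (t : ℝ) (k : ℕ) :
    (2 * Real.pi)⁻¹ * ∫ θ in (0 : ℝ)..(2 * Real.pi), (t * Real.cos θ) ^ (2 * k) =
      (2 * k).factorial * ((t ^ 2 / 4) ^ k / (k.factorial : ℝ) ^ 2) := by
  simp_rw [mul_pow]
  rw [intervalIntegral.integral_const_mul, integral_cos_pow_two_mul, div_pow, pow_mul]
  have := Real.pi_pos
  field_simp

open Finset in
-- Put x = t cos θ and average over θ: positivity persists and the means of even powers are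
-- explicit. The shift j is 0 for J₀ and 1 for t J₁.
theorem mean_nonneg_of_alternating {f : ℝ → ℝ} (hf : Continuous f) (t : ℝ) (n j : ℕ) (a : ℕ → ℝ)
    (h : ∀ x, 0 ≤ (-1) ^ (n + 1) *
      (f x - ∑ k ∈ range (n + 1), (-1) ^ k * (x ^ (2 * (k + j)) / a k))) :
    0 ≤ (-1) ^ (n + 1) * ((2 * Real.pi)⁻¹ * (∫ θ in (0 : ℝ)..(2 * Real.pi), f (t * Real.cos θ)) -
      ∑ k ∈ range (n + 1), (-1) ^ k *
        ((2 * (k + j)).factorial * ((t ^ 2 / 4) ^ (k + j) / ((k + j).factorial : ℝ) ^ 2) /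
          a k)) := by
  have h2 : (0 : ℝ) ≤ 2 * Real.pi := by positivity
  have hI := intervalIntegral.integral_nonneg (μ := volume) h2
    (fun θ _ => h (t * Real.cos θ))
  rw [intervalIntegral.integral_const_mul, intervalIntegral.integral_sub
    (Continuous.intervalIntegrable (by fun_prop) _ _)
    (Continuous.intervalIntegrable (by fun_prop) _ _),
    intervalIntegral.integral_finsetSum
    (fun k _ => Continuous.intervalIntegrable (by fun_prop) _ _)] at hI
  convert! mul_nonneg (inv_nonneg.2 h2) hI using 1
  rw [mul_left_comm (2 * Real.pi)⁻¹]
  congr 1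
  rw [mul_sub (2 * Real.pi)⁻¹, mul_sum]
  congr 1
  refine sum_congr rfl fun k _ => ?_
  rw [intervalIntegral.integral_const_mul, intervalIntegral.integral_div, ← mean_mul_cos_pow]
  ring

open Finset in
theorem besselJZero_alternating (t : ℝ) (n : ℕ) :
    0 ≤ (-1) ^ (n + 1) * (besselJZero t -
      ∑ k ∈ range (n + 1), (-1) ^ k * ((t ^ 2 / 4) ^ k / (k.factorial : ℝ) ^ 2)) := by
  have h := mean_nonneg_of_alternating Real.continuous_cos t n 0 (fun k => (2 * k).factorial)
    (cos_taylor_alternating n)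
  refine h.trans_eq ?_
  congr 2
  refine sum_congr rfl fun k _ => ?_
  have : ((2 * k).factorial : ℝ) ≠ 0 := by positivity
  simp only [add_zero]
  field_simp

open Finset in
theorem mul_besselJOne_alternating (t : ℝ) (n : ℕ) :
    0 ≤ (-1) ^ (n + 1) * (t * besselJOne t - ∑ k ∈ range (n + 1),
      (-1) ^ k * ((2 * k + 2) * (t ^ 2 / 4) ^ (k + 1) / ((k + 1).factorial : ℝ) ^ 2)) := by
  have h := mean_nonneg_of_alternating (f := fun x => x * Real.sin x) (by fun_prop) t n 1
    (fun k => (2 * k + 1).factorial) (mul_sin_taylor_alternating n)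
  refine h.trans_eq ?_
  congr 2
  · rw [besselJOne, mul_left_comm, ← intervalIntegral.integral_const_mul t]
    simp_rw [mul_assoc]
  · refine sum_congr rfl fun k _ => ?_
    have h1 : ((2 * k + 1).factorial : ℝ) ≠ 0 := by positivity
    have h2 : (2 * (k + 1)).factorial = (2 * k + 2) * (2 * k + 1).factorial := rfl
    rw [h2]
    push_cast
    field_simp

theorem hasDerivAt_besselJZero (t : ℝ) : HasDerivAt besselJZero (-besselJOne t) t := by
  have h := (intervalIntegral.hasDerivAt_integral_of_dominated_loc_of_deriv_le
    (μ := volume) (a := 0) (b := 2 * Real.pi) (x₀ := t) (s := Set.univ)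
    (F := fun t θ => Real.cos (t * Real.cos θ))
    (F' := fun t θ => -(Real.cos θ * Real.sin (t * Real.cos θ))) (bound := fun _ => 1) univ_mem
    (.of_forall fun x => Continuous.aestronglyMeasurable (by fun_prop))
    (Continuous.intervalIntegrable (by fun_prop) _ _)
    (Continuous.aestronglyMeasurable (by fun_prop))
    (.of_forall fun θ _ x _ => ?_) intervalIntegrable_const
    (.of_forall fun θ _ x _ => ?_)).2
  · convert! h.const_mul (2 * Real.pi)⁻¹ using 1
    rw [besselJOne, intervalIntegral.integral_neg]
    ring
  · rw [norm_neg, norm_mul]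
    exact mul_le_one₀ (Real.abs_cos_le_one _) (norm_nonneg _) (Real.abs_sin_le_one _)
  · convert! (((hasDerivAt_id x).mul_const (Real.cos θ)).cos) using 1
    simp
    ring

/-- Integration by parts: sin θ sin(t cos θ) vanishes at both ends. This yields the term J₁/t in
J₁'. -/
theorem mul_integral_sin_sq_mul_cos (t : ℝ) :
    t * ∫ θ in (0 : ℝ)..(2 * Real.pi), Real.sin θ ^ 2 * Real.cos (t * Real.cos θ) =
      ∫ θ in (0 : ℝ)..(2 * Real.pi), Real.cos θ * Real.sin (t * Real.cos θ) := by
  have h := intervalIntegral.integral_eq_sub_of_hasDerivAt (a := 0) (b := 2 * Real.pi)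
    (f := fun θ => Real.sin θ * Real.sin (t * Real.cos θ))
    (f' := fun θ => Real.cos θ * Real.sin (t * Real.cos θ)
      - t * (Real.sin θ ^ 2 * Real.cos (t * Real.cos θ))) (fun θ _ => ?_)
    (Continuous.intervalIntegrable (by fun_prop) _ _)
  · rw [intervalIntegral.integral_sub (Continuous.intervalIntegrable (by fun_prop) _ _)
      (Continuous.intervalIntegrable (by fun_prop) _ _),
      intervalIntegral.integral_const_mul] at h
    simp at h
    linarith
  · convert! (Real.hasDerivAt_sin θ).mul ((Real.hasDerivAt_cos θ).const_mul t).sin using 1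
    ring

theorem hasDerivAt_besselJOne {t : ℝ} (ht : t ≠ 0) :
    HasDerivAt besselJOne (besselJZero t - besselJOne t / t) t := by
  have h := (intervalIntegral.hasDerivAt_integral_of_dominated_loc_of_deriv_le
    (μ := volume) (a := 0) (b := 2 * Real.pi) (x₀ := t) (s := Set.univ)
    (F := fun t θ => Real.cos θ * Real.sin (t * Real.cos θ))
    (F' := fun t θ => Real.cos (t * Real.cos θ) - Real.sin θ ^ 2 * Real.cos (t * Real.cos θ))
    (bound := fun _ => 1) univ_mem
    (.of_forall fun x => Continuous.aestronglyMeasurable (by fun_prop))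
    (Continuous.intervalIntegrable (by fun_prop) _ _)
    (Continuous.aestronglyMeasurable (by fun_prop))
    (.of_forall fun θ _ x _ => ?_) intervalIntegrable_const
    (.of_forall fun θ _ x _ => ?_)).2
  · convert! h.const_mul (2 * Real.pi)⁻¹ using 1
    rw [besselJOne, besselJZero, intervalIntegral.integral_sub
      (Continuous.intervalIntegrable (by fun_prop) _ _)
      (Continuous.intervalIntegrable (by fun_prop) _ _), ← mul_integral_sin_sq_mul_cos]
    field_simp
  · have e : Real.cos (x * Real.cos θ) - Real.sin θ ^ 2 * Real.cos (x * Real.cos θ) =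
        Real.cos θ ^ 2 * Real.cos (x * Real.cos θ) := by rw [Real.cos_sq' θ]; ring
    rw [e, norm_mul, norm_pow]
    exact mul_le_one₀ (pow_le_one₀ (norm_nonneg _) (Real.abs_cos_le_one _)) (norm_nonneg _)
      (Real.abs_cos_le_one _)
  · convert! (((hasDerivAt_id x).mul_const (Real.cos θ)).sin).const_mul (Real.cos θ) using 1
    simp only [id, Real.sin_sq]
    ring

/-- The energy `J₀² + J₁²` decreases. -/
theorem bessel_energy_antitoneOn :
    AntitoneOn (fun t => besselJZero t ^ 2 + besselJOne t ^ 2) (Set.Ioi 0) := by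
  -- The cross terms ∓2J₀J₁ cancel.
  have hd : ∀ t ∈ Set.Ioi (0 : ℝ), HasDerivAt (fun t => besselJZero t ^ 2 + besselJOne t ^ 2)
      (-(2 * besselJOne t ^ 2 / t)) t := by
    intro t ht
    convert! ((hasDerivAt_besselJZero t).pow 2).add
      ((hasDerivAt_besselJOne (ne_of_gt (Set.mem_Ioi.1 ht))).pow 2) using 1
    push_cast
    ring
  refine antitoneOn_of_deriv_nonpos (convex_Ioi 0)
    (fun t ht => (hd t ht).continuousAt.continuousWithinAt)
    (fun t ht => (hd t (interior_subset ht)).differentiableAt.differentiableWithinAt)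
    fun t ht => ?_
  have ht := interior_subset ht
  rw [(hd t ht).deriv, neg_nonpos]
  have : 0 < t := ht
  positivity

/-- J₀(t)² is at most the energy at 6, which consecutive partial sums bound by 0.151² + 0.277² <
0.32². -/
theorem abs_besselJZero_le {t : ℝ} (ht : 6 ≤ t) : |besselJZero t| ≤ 8 / 25 := by
  have hE := bessel_energy_antitoneOn (Set.mem_Ioi.2 (by norm_num : (0 : ℝ) < 6))
    (Set.mem_Ioi.2 (by linarith : (0 : ℝ) < t)) ht
  have a1 := besselJZero_alternating 6 9
  have a2 := besselJZero_alternating 6 10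
  have b1 := mul_besselJOne_alternating 6 9
  have b2 := mul_besselJOne_alternating 6 10
  norm_num [Finset.sum_range_succ, Nat.factorial] at a1 a2 b1 b2
  have c0 : besselJZero 6 ^ 2 ≤ (151 / 1000) ^ 2 := sq_le_sq' (by linarith) (by linarith)
  have c1 : besselJOne 6 ^ 2 ≤ (277 / 1000) ^ 2 := sq_le_sq' (by linarith) (by linarith)
  refine abs_le_of_sq_le_sq ?_ (by norm_num)
  simp only at hE
  nlinarith [sq_nonneg (besselJOne t)]

/-- The Fourier transform of the measure governing monochromatic triangles is bounded below. -/
theorem bessel_lower_bound {t : ℝ} (ht : 0 ≤ t) :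
    0 ≤ 9684 / 10000 + 2 * besselJZero t + besselJZero (√2 * t) := by
  -- Up to 6 both series are truncated after s⁹, s = t²/4 ≤ 9, with 2s in place of s for √2 t.
  -- Beyond 6, 3 · 0.32 = 0.96 suffices.
  rcases le_total t 6 with h | h
  · have h1 := besselJZero_alternating t 9
    have h2 := besselJZero_alternating (√2 * t) 9
    have h3 := minorant_nonneg (s := t ^ 2 / 4) (by positivity) (by nlinarith)
    have e : (√2 * t) ^ 2 / 4 = 2 * (t ^ 2 / 4) := by
      rw [mul_pow, Real.sq_sqrt (by norm_num)]; ring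
    rw [e] at h2
    generalize t ^ 2 / 4 = s at *
    norm_num [Finset.sum_range_succ, Nat.factorial, mul_pow] at h1 h2
    linarith
  · have h1 := abs_le.1 (abs_besselJZero_le h)
    have h2 := abs_le.1 (abs_besselJZero_le (t := √2 * t)
      (by nlinarith [Real.one_le_sqrt.2 (by norm_num : (1 : ℝ) ≤ 2)]))
    linarith [h1.1, h2.1]

/-! ### Autocorrelation and the Fourier transform -/

open scoped FourierTransform SchwartzMap

/-- The autocorrelation `Re ⟨U, U(· + v)⟩` of a square integrable function. -/
def corr (U : Lp ℂ 2 (volume : Measure Plane)) (v : Plane) : ℝ :=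
  (inner ℂ U (Lp.compMeasurePreserving (· + v) (measurePreserving_add_right volume v) U)).re

/-- Translations act continuously on L². Continuity in the function permits the density argument,
continuity in the shift the circle integrals. -/
theorem continuous_corr :
    Continuous fun p : Lp ℂ 2 (volume : Measure Plane) × Plane => corr p.1 p.2 := by
  refine Complex.continuous_re.comp (continuous_fst.inner ?_)
  refine Continuous.compMeasurePreservingLp (Z := Lp ℂ 2 (volume : Measure Plane) × Plane)
    (g := fun z => (⟨fun x => x + z.2, by fun_prop⟩ : C(Plane, Plane)))
    continuous_fst ?_ (fun z => measurePreserving_add_right volume z.2) (by norm_num)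
  exact ContinuousMap.continuous_of_continuous_uncurry _
    (by simp only [Function.uncurry_def, ContinuousMap.coe_mk]; fun_prop)

theorem corr_toLp {f : Plane → ℂ} (hf : MemLp f 2 volume) (v : Plane) :
    corr (hf.toLp f) v = (∫ x, inner ℂ (f x) (f (x + v))).re := by
  rw [corr, L2.inner_def, Lp.toLp_compMeasurePreserving]
  congr 1
  refine integral_congr_ae ?_
  filter_upwards [hf.coeFn_toLp,
    (hf.comp_measurePreserving (measurePreserving_add_right volume v)).coeFn_toLp] with x h1 h2
  rw [h1, h2]
  rfl

theorem corr_zero (U : Lp ℂ 2 (volume : Measure Plane)) : corr U 0 = ‖U‖ ^ 2 := by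
  have h : Lp.compMeasurePreserving (· + (0 : Plane)) (measurePreserving_add_right volume 0) U =
      U := by
    ext1
    filter_upwards [Lp.coeFn_compMeasurePreserving U
      (measurePreserving_add_right volume 0)] with x hx
    rw [hx]
    simp
  rw [corr, h, inner_self_eq_norm_sq_to_K]
  norm_cast

theorem continuous_dir : Continuous dir := by
  unfold dir
  refine (PiLp.continuous_toLp 2 _).comp (continuous_pi fun i => ?_)
  fin_cases i
  · exact Real.continuous_cos
  · exact Real.continuous_sin

theorem dir_add_two_pi (θ : ℝ) : dir (θ + 2 * Real.pi) = dir θ := by simp [dir]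

theorem integral_shift_of_dir (F : Plane → ℝ) (φ : ℝ) :
    ∫ θ in (0 : ℝ)..(2 * Real.pi), F (dir (θ + φ)) = ∫ θ in (0 : ℝ)..(2 * Real.pi), F (dir θ) := by
  have hp : Function.Periodic (fun θ => F (dir θ)) (2 * Real.pi) := fun θ => by
    simp only [dir_add_two_pi]
  rw [intervalIntegral.integral_comp_add_right (fun θ => F (dir θ)), add_comm (2 * Real.pi)]
  simpa using hp.intervalIntegral_add_eq (0 + φ) 0

/-- Rotating the circle by the polar angle of ξ turns the inner product into r‖ξ‖ cos θ. -/
theorem integral_cos_inner_dir (r : ℝ) (ξ : Plane) :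
    ∫ θ in (0 : ℝ)..(2 * Real.pi), Real.cos (2 * Real.pi * inner ℝ (r • dir θ) ξ) =
      2 * Real.pi * besselJZero (2 * Real.pi * r * ‖ξ‖) := by
  obtain ⟨α, hα⟩ : ∃ α, ξ = ‖ξ‖ • dir α := by
    refine ⟨Complex.arg ⟨ξ 0, ξ 1⟩, ?_⟩
    have hn : ‖ξ‖ = ‖(⟨ξ 0, ξ 1⟩ : ℂ)‖ := by
      rw [EuclideanSpace.norm_eq, Complex.norm_eq_sqrt_sq_add_sq, Fin.sum_univ_two]
      simp
    rw [hn]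
    ext i
    fin_cases i
    · simp [dir, Complex.norm_mul_cos_arg]
    · simp [dir, Complex.norm_mul_sin_arg]
  have hin : ∀ θ, inner ℝ (r • dir (θ + α)) ξ = r * ‖ξ‖ * Real.cos θ := by
    intro θ
    have : inner ℝ (dir (θ + α)) (dir α) = Real.cos θ := by
      rw [show Real.cos θ = Real.cos (θ + α - α) by simp, Real.cos_sub]
      simp [dir, PiLp.inner_apply, Fin.sum_univ_two]
      ring
    conv_lhs => rw [hα]
    rw [inner_smul_left, inner_smul_right, this]
    simp
    ring
  rw [← integral_shift_of_dir (fun y => Real.cos (2 * Real.pi * inner ℝ (r • y) ξ)) α]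
  simp_rw [hin]
  rw [besselJZero, mul_inv_cancel_left₀ (by positivity)]
  congr! 3
  ring

theorem integrable_sq_fourier (V : 𝓢(Plane, ℂ)) : Integrable fun ξ => ‖𝓕 V ξ‖ ^ 2 := by
  simpa using ((𝓕 V).memLp 2 volume).integrable_norm_pow (by norm_num)

/-- Parseval, since translation by v multiplies the transform by exp(2πi⟨v, ξ⟩). -/
theorem corr_schwartz (V : 𝓢(Plane, ℂ)) (v : Plane) :
    corr (V.toLp 2) v = ∫ ξ, Real.cos (2 * Real.pi * inner ℝ v ξ) * ‖𝓕 V ξ‖ ^ 2 := by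
  have hF : ∀ ξ, 𝓕 (V.compSubConstCLM ℂ (-v)) ξ =
      Complex.exp ((2 * Real.pi * inner ℝ v ξ : ℝ) * Complex.I) * 𝓕 V ξ := by
    intro ξ
    have h := congrFun (VectorFourier.fourierIntegral_comp_add_right Real.fourierChar
      (volume : Measure Plane) (innerₗ Plane) V v) ξ
    rw [SchwartzMap.fourier_coe, SchwartzMap.fourier_coe]
    have e : (⇑(V.compSubConstCLM ℂ (-v))) = V ∘ fun x => x + v := by
      funext x; simp
    rw [e]
    convert! h using 1
  have h := SchwartzMap.integral_inner_fourier_fourier V (V.compSubConstCLM ℂ (-v))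
  have hc := corr_toLp (V.memLp 2 volume) v
  rw [SchwartzMap.toLp, hc]
  simp only [SchwartzMap.compSubConstCLM_apply, sub_neg_eq_add] at h
  rw [← h]
  have hi : ∀ ξ, inner ℂ (𝓕 V ξ) (𝓕 (V.compSubConstCLM ℂ (-v)) ξ) =
      Complex.exp ((2 * Real.pi * inner ℝ v ξ : ℝ) * Complex.I) * ((‖𝓕 V ξ‖ ^ 2 : ℝ) : ℂ) := by
    intro ξ
    rw [hF, ← smul_eq_mul, inner_smul_right, inner_self_eq_norm_sq_to_K]
    simp
  simp_rw [hi]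
  rw [← Complex.reCLM_apply, ← ContinuousLinearMap.integral_comp_comm]
  · congr! 2 with ξ
    rw [Complex.reCLM_apply, Complex.re_mul_ofReal, Complex.exp_ofReal_mul_I_re]
  · refine (integrable_sq_fourier V).ofReal.bdd_mul (c := 1)
      (Continuous.aestronglyMeasurable (by fun_prop)) ?_
    exact .of_forall fun ξ => by rw [Complex.norm_exp_ofReal_mul_I]

/-- The integral of the autocorrelation over the circle of radius `r`. -/
def circleCorr (U : Lp ℂ 2 (volume : Measure Plane)) (r : ℝ) : ℝ :=
  ∫ θ in (0 : ℝ)..(2 * Real.pi), corr U (r • dir θ)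

theorem continuous_circleCorr (r : ℝ) : Continuous fun U => circleCorr U r := by
  refine intervalIntegral.continuous_parametric_intervalIntegral_of_continuous' ?_ _ _
  have := continuous_dir
  exact continuous_corr.comp (f := fun p : Lp ℂ 2 (volume : Measure Plane) × ℝ =>
    (p.1, r • dir p.2)) (by fun_prop)

theorem continuous_besselJZero : Continuous besselJZero :=
  continuous_iff_continuousAt.2 fun t => (hasDerivAt_besselJZero t).continuousAt

theorem abs_besselJZero_le_one (t : ℝ) : |besselJZero t| ≤ 1 := by
  have h2 : (0 : ℝ) < 2 * Real.pi := by positivity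
  have h := intervalIntegral.norm_integral_le_of_norm_le_const (a := 0) (b := 2 * Real.pi) (C := 1)
    (f := fun θ => Real.cos (t * Real.cos θ)) fun θ _ => Real.abs_cos_le_one _
  rw [besselJZero, abs_mul, abs_of_pos (inv_pos.2 h2)]
  rw [sub_zero, abs_of_pos h2, one_mul, Real.norm_eq_abs] at h
  exact (mul_le_mul_of_nonneg_left h (inv_pos.2 h2).le).trans_eq (inv_mul_cancel₀ h2.ne')

theorem integrable_besselJZero_mul (V : 𝓢(Plane, ℂ)) (a : ℝ) :
    Integrable fun ξ => besselJZero (a * ‖ξ‖) * ‖𝓕 V ξ‖ ^ 2 := by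
  have := continuous_besselJZero
  exact (integrable_sq_fourier V).bdd_mul (c := 1)
    (Continuous.aestronglyMeasurable (by fun_prop)) (.of_forall fun ξ => abs_besselJZero_le_one _)

theorem circleCorr_schwartz (V : 𝓢(Plane, ℂ)) (r : ℝ) :
    circleCorr (V.toLp 2) r =
      2 * Real.pi * ∫ ξ, besselJZero (2 * Real.pi * r * ‖ξ‖) * ‖𝓕 V ξ‖ ^ 2 := by
  rw [circleCorr]
  simp_rw [corr_schwartz]
  have hd := continuous_dir
  rw [intervalIntegral.integral_of_le (by positivity), integral_integral_swap, ← integral_const_mul]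
  · congr! 2 with ξ
    rw [integral_mul_const, ← intervalIntegral.integral_of_le (by positivity),
      integral_cos_inner_dir, mul_assoc]
  · have h1 : Integrable (fun p : ℝ × Plane => ‖𝓕 V p.2‖ ^ 2)
        ((volume.restrict (Set.Ioc 0 (2 * Real.pi))).prod volume) :=
      (integrable_sq_fourier V).comp_snd _
    exact h1.bdd_mul (c := 1) (Continuous.aestronglyMeasurable (by fun_prop))
      (.of_forall fun ξ => Real.abs_cos_le_one _)

/-- The inequality is closed in U, so Schwartz functions suffice; for them `bessel_lower_bound` is
integrated against |V̂|². -/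
theorem circleCorr_lower_bound (U : Lp ℂ 2 (volume : Measure Plane)) {l : ℝ} (hl : 0 ≤ l) :
    0 ≤ 9684 / 10000 * (2 * Real.pi) * ‖U‖ ^ 2 + 2 * circleCorr U l + circleCorr U (√2 * l) := by
  have h1 := continuous_circleCorr l
  have h2 := continuous_circleCorr (√2 * l)
  refine (SchwartzMap.denseRange_toLpCLM (E := Plane) (F := ℂ) (μ := volume) (p := 2)
    (by norm_num)).induction_on
    (p := fun U => 0 ≤ 9684 / 10000 * (2 * Real.pi) * ‖U‖ ^ 2 + 2 * circleCorr U l +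
      circleCorr U (√2 * l)) U (isClosed_le continuous_const (by fun_prop)) fun V => ?_
  rw [SchwartzMap.toLpCLM_apply]
  have hn : ‖V.toLp 2‖ ^ 2 = ∫ ξ, ‖𝓕 V ξ‖ ^ 2 := by
    rw [← corr_zero, corr_schwartz]
    simp
  rw [hn, circleCorr_schwartz, circleCorr_schwartz]
  have i0 := integrable_sq_fourier V
  have i1 := integrable_besselJZero_mul V (2 * Real.pi * l)
  have i2 := integrable_besselJZero_mul V (2 * Real.pi * (√2 * l))
  have key : 0 ≤ ∫ ξ, (9684 / 10000 * ‖𝓕 V ξ‖ ^ 2 +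
      2 * (besselJZero (2 * Real.pi * l * ‖ξ‖) * ‖𝓕 V ξ‖ ^ 2) +
      besselJZero (2 * Real.pi * (√2 * l) * ‖ξ‖) * ‖𝓕 V ξ‖ ^ 2) := by
    refine integral_nonneg fun ξ => ?_
    have := mul_nonneg (bessel_lower_bound (t := 2 * Real.pi * l * ‖ξ‖) (by positivity))
      (sq_nonneg ‖𝓕 V ξ‖)
    rw [show √2 * (2 * Real.pi * l * ‖ξ‖) = 2 * Real.pi * (√2 * l) * ‖ξ‖ by ring] at this
    simp only [Pi.zero_apply]
    linarith
  rw [integral_add ((i0.const_mul _).fun_add (i1.const_mul _)) i2,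
    integral_add (i0.const_mul _) (i1.const_mul _), integral_const_mul, integral_const_mul] at key
  have := mul_nonneg (by positivity : 0 ≤ 2 * Real.pi) key
  linarith

/-! ### Sides of triangles -/

theorem perp_smul_dir (l θ : ℝ) : perp (l • dir θ) = l • dir (θ + Real.pi / 2) := by
  ext i
  fin_cases i <;> simp [perp, dir, Real.cos_add_pi_div_two, Real.sin_add_pi_div_two]

theorem perp_smul_dir_sub (l θ : ℝ) :
    perp (l • dir θ) - l • dir θ = (√2 * l) • dir (θ + 3 * Real.pi / 4) := by
  have hc : Real.cos (3 * Real.pi / 4) = -(√2 / 2) := by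
    rw [show 3 * Real.pi / 4 = Real.pi - Real.pi / 4 by ring, Real.cos_pi_sub, Real.cos_pi_div_four]
  have hs : Real.sin (3 * Real.pi / 4) = √2 / 2 := by
    rw [show 3 * Real.pi / 4 = Real.pi - Real.pi / 4 by ring, Real.sin_pi_sub, Real.sin_pi_div_four]
  have h2 : √2 * √2 = 2 := Real.mul_self_sqrt (by norm_num)
  ext i
  fin_cases i
  · simp [perp, dir, Real.cos_add, hc, hs]
    linear_combination (l * (Real.cos θ + Real.sin θ) / 2) * h2
  · simp [perp, dir, Real.sin_add, hc, hs]
    linear_combination (-l * (Real.cos θ - Real.sin θ) / 2) * h2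

theorem abs_dir_apply_le_one (θ : ℝ) (i : Fin 2) : |dir θ i| ≤ 1 := by
  fin_cases i
  · simpa [dir] using Real.abs_cos_le_one θ
  · simpa [dir] using Real.abs_sin_le_one θ

theorem corr_ofReal {g : Plane → ℝ} (hg : MemLp g 2 volume) (v : Plane) :
    corr (hg.ofReal.toLp (fun x => (g x : ℂ))) v = ∫ x, g x * g (x + v) := by
  rw [corr_toLp]
  have : ∀ x, inner ℂ (g x : ℂ) (g (x + v) : ℂ) = ((g x * g (x + v) : ℝ) : ℂ) := by
    intro x
    simp [mul_comm]
  simp_rw [this]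
  rw [integral_complex_ofReal, Complex.ofReal_re]

/-- The sum of the products of the values of `g` at the ends of the three sides of a triangle. -/
def sideSum (g : Plane → ℝ) (l : ℝ) (x : Plane) (θ : ℝ) : ℝ :=
  g x * g (x + l • dir θ) + g x * g (x + perp (l • dir θ)) +
    g (x + l • dir θ) * g (x + perp (l • dir θ))

/-- Integrated over x, each side gives an autocorrelation; integrated over θ, the angles π/2 and
3π/4 drop out and only the side lengths remain. -/
theorem integral_sideSum_ge {g : Plane → ℝ} (hg : MemLp g 2 volume) {l : ℝ} (hl : 0 ≤ l) :
    -(9684 / 10000 * (2 * Real.pi) * ∫ x, g x ^ 2) ≤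
      ∫ θ in (0 : ℝ)..(2 * Real.pi), ∫ x, sideSum g l x θ := by
  set U := hg.ofReal.toLp (fun x => (g x : ℂ)) with hU
  have hs : ∀ v, MemLp (fun x => g (x + v)) 2 volume := fun v =>
    hg.comp_measurePreserving (measurePreserving_add_right volume v)
  have hx : ∀ θ, ∫ x, sideSum g l x θ = corr U (l • dir θ) + corr U (l • dir (θ + Real.pi / 2)) +
      corr U ((√2 * l) • dir (θ + 3 * Real.pi / 4)) := by
    intro θ
    simp only [sideSum]
    rw [integral_add, integral_add, ← perp_smul_dir, ← perp_smul_dir_sub, hU, corr_ofReal,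
      corr_ofReal, corr_ofReal]
    · congr 1
      -- Translation moves the start of the hypotenuse to x.
      rw [← integral_add_right_eq_self (fun x => g x * g (x + (perp (l • dir θ) - l • dir θ)))
        (l • dir θ)]
      simp
    all_goals first
      | exact hg
      | exact hg.integrable_mul (hs _)
      | exact (hs _).integrable_mul (hs _)
      | exact (hg.integrable_mul (hs _)).add (hg.integrable_mul (hs _))
  have hcont : ∀ r φ : ℝ, Continuous fun θ => corr U (r • dir (θ + φ)) := fun r φ => by
    have := continuous_dir
    exact continuous_corr.comp (f := fun θ => (U, r • dir (θ + φ))) (by fun_prop)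
  have hcont0 : Continuous fun θ => corr U (l • dir θ) := by simpa using hcont l 0
  have hn : ‖U‖ ^ 2 = ∫ x, g x ^ 2 := by
    rw [← corr_zero, hU, corr_ofReal hg]
    simp [sq]
  have hb := circleCorr_lower_bound U hl
  simp_rw [hx]
  rw [intervalIntegral.integral_add ((hcont0.fun_add (hcont _ _)).intervalIntegrable _ _)
    ((hcont _ _).intervalIntegrable _ _), intervalIntegral.integral_add
    (hcont0.intervalIntegrable _ _) ((hcont _ _).intervalIntegrable _ _),
    integral_shift_of_dir (fun y => corr U (l • y)),
    integral_shift_of_dir (fun y => corr U ((√2 * l) • y)), ← hn]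
  unfold circleCorr at hb
  linarith

/-! ### Truncation to a box -/

theorem measurableSet_box (T : ℝ) : MeasurableSet (box T) := by
  unfold box
  simp only [Set.ofPred_forall]
  exact MeasurableSet.iInter fun i => measurableSet_Icc.preimage (by fun_prop)

theorem volume_box {T : ℝ} (hT : 0 ≤ T) : volume (box T) = ENNReal.ofReal ((2 * T) ^ 2) := by
  have h : box T = (WithLp.ofLp (p := 2)) ⁻¹' (Set.Icc (fun _ : Fin 2 => -T) (fun _ => T)) := by
    ext x
    simp [box, Set.mem_Icc, Pi.le_def, forall_and]
  rw [h, (PiLp.volume_preserving_ofLp (Fin 2)).measure_preimage measurableSet_Icc.nullMeasurableSet,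
    Real.volume_Icc_pi, Fin.prod_const, ← ENNReal.ofReal_pow (by linarith)]
  congr 2
  ring

theorem mem_box_of_add_smul_dir {x : Plane} {T l θ : ℝ} (hl : 0 ≤ l) (h : x ∈ box T) :
    x + l • dir θ ∈ box (T + l) := by
  intro i
  have h1 := h i
  have h2 := abs_le.1 (abs_dir_apply_le_one θ i)
  simp only [Set.mem_Icc, PiLp.add_apply, PiLp.smul_apply, smul_eq_mul] at h1 ⊢
  constructor <;> nlinarith

/-- The colouring as a function with values `±1`. -/
def sign (c : Plane → Fin 2) (x : Plane) : ℝ := if c x = 0 then 1 else -1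

theorem sign_eq (c : Plane → Fin 2) (x : Plane) : sign c x = 1 ∨ sign c x = -1 := by
  unfold sign; split_ifs <;> simp

theorem sideSum_sign (c : Plane → Fin 2) (l : ℝ) (x : Plane) (θ : ℝ) [Decidable (IsMono c l x θ)] :
    sideSum (sign c) l x θ = if IsMono c l x θ then 3 else -1 := by
  have h : ∀ a : Fin 2, a = 0 ∨ a = 1 := by decide
  simp only [IsMono, sideSum, sign]
  rcases h (c x) with h1 | h1 <;> rcases h (c (x + l • dir θ)) with h2 | h2 <;>
    rcases h (c (x + perp (l • dir θ))) with h3 | h3 <;> simp [h1, h2, h3] <;> norm_num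

theorem box_subset_box {a b : ℝ} (hab : a ≤ b) : box a ⊆ box b := fun _ hy i =>
  ⟨by linarith [(hy i).1], by linarith [(hy i).2]⟩

theorem abs_indicator_sign_le_one (c : Plane → Fin 2) (s : Set Plane) (y : Plane) :
    |s.indicator (sign c) y| ≤ 1 := by
  by_cases hy : y ∈ s
  · rw [Set.indicator_of_mem hy]
    rcases sign_eq c y with h | h <;> simp [h]
  · simp [hy]

theorem abs_sideSum_le {c : Plane → Fin 2} {l T : ℝ} (hl : 0 ≤ l) (x : Plane) (θ : ℝ) :
    |sideSum ((box T).indicator (sign c)) l x θ| ≤ 3 * (box (T + l)).indicator 1 x := by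
  by_cases h2 : x ∈ box (T + l)
  · rw [Set.indicator_of_mem h2, Pi.one_apply]
    have hp : ∀ y z, |(box T).indicator (sign c) y * (box T).indicator (sign c) z| ≤ 1 := by
      intro y z
      rw [abs_mul]
      exact mul_le_one₀ (abs_indicator_sign_le_one c _ y) (abs_nonneg _)
        (abs_indicator_sign_le_one c _ z)
    unfold sideSum
    refine (abs_add_three _ _ _).trans ?_
    linarith [hp x (x + l • dir θ), hp x (x + perp (l • dir θ)),
      hp (x + l • dir θ) (x + perp (l • dir θ))]
  · have hx : x ∉ box T := fun h => h2 (box_subset_box (by linarith) h)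
    -- From the end of the leg, a step in direction θ + π returns to x. Every product in `sideSum`
    -- has x or this end as a factor.
    have hy : x + l • dir θ ∉ box T := fun h => h2 (by
      have := mem_box_of_add_smul_dir (θ := θ + Real.pi) hl h
      have e : dir (θ + Real.pi) = -dir θ := by
        ext i; fin_cases i <;> simp [dir]
      simpa [e] using this)
    simp [sideSum, hx, hy, h2]

/-- On the inner box no vertex is cut off and -4 + 3 = -1 gives the exact value; elsewhere the crude
bound 3 is enough. -/
theorem sideSum_le {c : Plane → Fin 2} {l T : ℝ} (hl : 0 ≤ l) {x : Plane} {θ : ℝ}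
    (hθ : θ ∈ Set.Ico 0 (2 * Real.pi)) :
    sideSum ((box T).indicator (sign c)) l x θ ≤
      4 * (monoTriangles c l T).indicator 1 (x, θ) - 4 * (box (T - l)).indicator 1 x +
        3 * (box (T + l)).indicator 1 x := by
  classical
  have hm0 : (0 : ℝ) ≤ (monoTriangles c l T).indicator 1 (x, θ) :=
    Set.indicator_nonneg (fun _ _ => zero_le_one) _
  by_cases h1 : x ∈ box (T - l)
  · have hshift : ∀ φ, x + l • dir φ ∈ box T := fun φ => by
      simpa using mem_box_of_add_smul_dir (θ := φ) hl h1
    have hx : x ∈ box T := box_subset_box (by linarith) h1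
    have h2 : x ∈ box (T + l) := box_subset_box (by linarith) h1
    have e : sideSum ((box T).indicator (sign c)) l x θ = sideSum (sign c) l x θ := by
      simp only [sideSum, perp_smul_dir, Set.indicator_of_mem hx, Set.indicator_of_mem (hshift _)]
    rw [e, sideSum_sign, Set.indicator_of_mem h1, Set.indicator_of_mem h2]
    by_cases hm : IsMono c l x θ
    · have : (x, θ) ∈ monoTriangles c l T := ⟨⟨hx, hθ⟩, hm⟩
      rw [Set.indicator_of_mem this]
      norm_num [hm]
    · simp only [hm, if_false, Pi.one_apply]
      linarith
  · rw [Set.indicator_of_notMem h1]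
    linarith [(le_abs_self _).trans (abs_sideSum_le (c := c) (T := T) hl x θ)]

theorem measurableSet_monoTriangles {c : Plane → Fin 2} (hc : Measurable c) (l T : ℝ) :
    MeasurableSet (monoTriangles c l T) := by
  have hd := continuous_dir
  have h1 : Measurable fun p : Plane × ℝ => c p.1 := hc.comp measurable_fst
  have h2 : Measurable fun p : Plane × ℝ => c (p.1 + l • dir p.2) :=
    hc.comp (Continuous.measurable (by fun_prop))
  have h3 : Measurable fun p : Plane × ℝ => c (p.1 + perp (l • dir p.2)) := by
    simp_rw [perp_smul_dir]
    exact hc.comp (Continuous.measurable (by fun_prop))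
  exact ((measurableSet_box T).prod measurableSet_Ico).inter
    ((measurableSet_eq_fun h1 h2).inter (measurableSet_eq_fun h1 h3))

theorem volume_triangles {T : ℝ} (hT : 0 ≤ T) :
    volume (triangles T) = ENNReal.ofReal ((2 * T) ^ 2 * (2 * Real.pi)) := by
  rw [triangles, Measure.volume_eq_prod, Measure.prod_prod, volume_box hT, Real.volume_Ico,
    sub_zero, ← ENNReal.ofReal_mul (by positivity)]

theorem volume_monoTriangles_ne_top (c : Plane → Fin 2) (l : ℝ) {T : ℝ} (hT : 0 ≤ T) :
    volume (monoTriangles c l T) ≠ ∞ := by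
  have h : volume (monoTriangles c l T) ≤ volume (triangles T) := measure_mono fun p hp => hp.1
  rw [volume_triangles hT] at h
  exact (h.trans_lt ENNReal.ofReal_lt_top).ne

theorem volume_monoTriangles_ge {c : Plane → Fin 2} (hc : Measurable c) {l T : ℝ} (hl : 0 ≤ l)
    (hT : l ≤ T) :
    2 * Real.pi * (4 * (2 * (T - l)) ^ 2 - 3 * (2 * (T + l)) ^ 2 - 9684 / 10000 * (2 * T) ^ 2) ≤
      4 * volume.real (monoTriangles c l T) := by
  have hT0 : 0 ≤ T := hl.trans hT
  have hpi : (0 : ℝ) ≤ 2 * Real.pi := by positivity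
  have hd := continuous_dir
  have hbox : ∀ {a : ℝ}, 0 ≤ a → volume (box a) ≠ ∞ := fun ha => by simp [volume_box ha]
  have hboxr : ∀ {a : ℝ}, 0 ≤ a → volume.real (box a) = (2 * a) ^ 2 := fun ha => by
    rw [measureReal_def, volume_box ha, ENNReal.toReal_ofReal (by positivity)]
  have hsm : Measurable (sign c) :=
    Measurable.ite (hc (measurableSet_singleton 0)) measurable_const measurable_const
  set g := (box T).indicator (sign c) with hg
  have hgm : Measurable g := hsm.indicator (measurableSet_box T)
  have hgsq : ∀ y, g y ^ 2 = (box T).indicator 1 y := by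
    intro y
    by_cases hy : y ∈ box T
    · rw [hg, Set.indicator_of_mem hy, Set.indicator_of_mem hy]
      rcases sign_eq c y with h | h <;> simp [h]
    · simp [hg, hy]
  have hgL : MemLp g 2 volume := by
    rw [memLp_two_iff_integrable_sq hgm.aestronglyMeasurable]
    simp_rw [hgsq]
    exact (integrable_indicator_iff (measurableSet_box T)).2
      (integrableOn_const (hbox hT0))
  have hgI : ∫ x, g x ^ 2 = (2 * T) ^ 2 := by
    simp_rw [hgsq]
    rw [integral_indicator_one (measurableSet_box T), hboxr hT0]
  have key := integral_sideSum_ge hgL hl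
  rw [hgI] at key
  let ν : Measure ℝ := volume.restrict (Set.Ico 0 (2 * Real.pi))
  have hν : ν.real Set.univ = 2 * Real.pi := by simp [ν, hpi]
  have hprod : (volume : Measure Plane).prod ν =
      (volume : Measure (Plane × ℝ)).restrict (Set.univ ×ˢ Set.Ico 0 (2 * Real.pi)) := by
    rw [Measure.volume_eq_prod, ← Measure.prod_restrict, Measure.restrict_univ]
  have hMm := measurableSet_monoTriangles hc l T
  have hMsub : monoTriangles c l T ⊆ Set.univ ×ˢ Set.Ico 0 (2 * Real.pi) :=
    fun p hp => ⟨trivial, hp.1.2⟩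
  have hMeq : ((volume : Measure Plane).prod ν) (monoTriangles c l T) =
      volume (monoTriangles c l T) := by
    rw [hprod, Measure.restrict_apply hMm, Set.inter_eq_left.2 hMsub]
  have hMfin := volume_monoTriangles_ne_top c l hT0
  have hIbox : ∀ a, 0 ≤ a → Integrable (fun p : Plane × ℝ => (box a).indicator (1 : Plane → ℝ) p.1)
      ((volume : Measure Plane).prod ν) := fun a ha =>
    ((integrable_indicator_iff (measurableSet_box a)).2 (integrableOn_const (hbox ha))).comp_fst ν
  have hboxint : ∀ a, 0 ≤ a → ∫ p : Plane × ℝ, (box a).indicator (1 : Plane → ℝ) p.1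
      ∂((volume : Measure Plane).prod ν) = (2 * a) ^ 2 * (2 * Real.pi) := fun a ha => by
    rw [integral_fun_fst, hν, integral_indicator_one (measurableSet_box a), hboxr ha, smul_eq_mul,
      mul_comm]
  have hIM : Integrable ((monoTriangles c l T).indicator (1 : Plane × ℝ → ℝ))
      ((volume : Measure Plane).prod ν) :=
    (integrable_indicator_iff hMm).2 (integrableOn_const (by rw [hMeq]; exact hMfin))
  have hIS : Integrable (fun p : Plane × ℝ => sideSum g l p.1 p.2)
      ((volume : Measure Plane).prod ν) := by
    refine ((hIbox (T + l) (by linarith)).const_mul 3).mono' ?_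
      (.of_forall fun p => abs_sideSum_le hl p.1 p.2)
    simp only [sideSum, perp_smul_dir]
    have h1 : Measurable fun p : Plane × ℝ => g p.1 := hgm.comp measurable_fst
    have h2 : ∀ φ, Measurable fun p : Plane × ℝ => g (p.1 + l • dir (p.2 + φ)) := fun φ =>
      hgm.comp (Continuous.measurable (by fun_prop))
    have h3 := h2 0
    simp only [add_zero] at h3
    exact (((h1.mul h3).add (h1.mul (h2 _))).add (h3.mul (h2 _))).aestronglyMeasurable
  have hDint : Integrable (fun p : Plane × ℝ => (4 : ℝ) * (monoTriangles c l T).indicator 1 p -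
      4 * (box (T - l)).indicator 1 p.1) ((volume : Measure Plane).prod ν) :=
    (hIM.const_mul 4).sub ((hIbox _ (by linarith)).const_mul 4)
  have hRint : Integrable (fun p : Plane × ℝ => (4 : ℝ) * (monoTriangles c l T).indicator 1 p -
      4 * (box (T - l)).indicator 1 p.1 + 3 * (box (T + l)).indicator 1 p.1)
      ((volume : Measure Plane).prod ν) :=
    hDint.add ((hIbox _ (by linarith)).const_mul 3)
  have hle : ∫ p, sideSum g l p.1 p.2 ∂((volume : Measure Plane).prod ν) ≤
      ∫ p : Plane × ℝ, (4 * (monoTriangles c l T).indicator 1 p -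
      4 * (box (T - l)).indicator 1 p.1 + 3 * (box (T + l)).indicator 1 p.1)
        ∂((volume : Measure Plane).prod ν) := by
    refine integral_mono_ae hIS hRint ?_
    rw [hprod]
    filter_upwards [ae_restrict_mem (MeasurableSet.univ.prod measurableSet_Ico)] with p hp
    exact sideSum_le hl hp.2
  -- Fubini with θ outermost, as in `integral_sideSum_ge`.
  rw [integral_prod_symm _ hIS, integral_Ico_eq_integral_Ioc,
    ← intervalIntegral.integral_of_le hpi, integral_add hDint
      ((hIbox _ (by linarith)).const_mul 3), integral_sub (hIM.const_mul 4)
      ((hIbox _ (by linarith)).const_mul 4), integral_const_mul, integral_const_mul,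
    integral_const_mul, hboxint _ (by linarith), hboxint _ (by linarith),
    integral_indicator_one hMm, measureReal_def, hMeq, ← measureReal_def] at hle
  linarith

/-! ### Null sets and the limit -/

/-- For fixed θ each vertex is a translate of x, so null sets pull back to null sets. This allows a
Borel representative of the colouring. -/
theorem volume_monoTriangles_congr {c c' : Plane → Fin 2} (h : c =ᵐ[volume] c') (l T : ℝ) :
    volume (monoTriangles c l T) = volume (monoTriangles c' l T) := by
  have hd := continuous_dir
  have hshift : ∀ w : ℝ → Plane, Continuous w →
      ∀ᵐ p : Plane × ℝ, c (p.1 + w p.2) = c' (p.1 + w p.2) := by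
    intro w hw
    have hq : Measure.QuasiMeasurePreserving (fun p : Plane × ℝ => p.1 + w p.2)
        ((volume : Measure Plane).prod (volume : Measure ℝ)) volume :=
      MeasureTheory.QuasiMeasurePreserving.prod_of_left (Continuous.measurable (by fun_prop))
        (.of_forall fun θ => (measurePreserving_add_right volume (w θ)).quasiMeasurePreserving)
    exact hq.ae h
  refine measure_congr ?_
  filter_upwards [hshift (fun _ => 0) continuous_const, hshift (fun θ => l • dir θ) (by fun_prop),
    hshift (fun θ => perp (l • dir θ)) (by simp only [perp_smul_dir]; fun_prop)] with p h1 h2 h3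
  simp only [add_zero] at h1
  refine propext (and_congr_right fun _ => ?_)
  simp only [IsMono, h1, h2, h3]

end MonoTriangle

end

theorem mainTheorem6 (c : MonoTriangle.Plane → Fin 2) (hc : NullMeasurable c volume)
    (l : ℝ) (hl : 0 < l) :
    (79 / 10000 : ℝ≥0∞) ≤ MonoTriangle.monoMeasure c l := by
  have hae : AEMeasurable c volume := hc.aemeasurable
  -- The bound of `volume_monoTriangles_ge` divided by 4 · 2π(2T)²; its limit is (4 - 3 - 0.9684)/4.
  let F : ℝ → ℝ := fun T => (4 * (1 - l * T⁻¹) ^ 2 - 3 * (1 + l * T⁻¹) ^ 2 - 9684 / 10000) / 4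
  have hF : Tendsto F atTop (nhds (79 / 10000)) := by
    have h := (tendsto_inv_atTop_zero (𝕜 := ℝ)).const_mul l
    have h2 := (((((h.const_sub 1).pow 2).const_mul 4).sub
      (((h.const_add 1).pow 2).const_mul 3)).sub_const (9684 / 10000)).div_const 4
    convert! h2 using 2
    norm_num
  have hle : ∀ᶠ T in atTop, ENNReal.ofReal (F T) ≤
      volume (MonoTriangle.monoTriangles c l T) / volume (MonoTriangle.triangles T) := by
    filter_upwards [eventually_ge_atTop l] with T hT
    have hT0 : 0 < T := hl.trans_le hT
    have hpi := Real.pi_pos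
    have hfin := MonoTriangle.volume_monoTriangles_ne_top c l hT0.le
    have h := MonoTriangle.volume_monoTriangles_ge hae.measurable_mk hl.le hT
    rw [measureReal_def, ← MonoTriangle.volume_monoTriangles_congr hae.ae_eq_mk] at h
    rw [MonoTriangle.volume_triangles hT0.le, ← ENNReal.ofReal_toReal hfin,
      ← ENNReal.ofReal_div_of_pos (by positivity)]
    refine ENNReal.ofReal_le_ofReal ?_
    rw [le_div_iff₀ (by positivity)]
    have e : F T * ((2 * T) ^ 2 * (2 * Real.pi)) = 2 * Real.pi * (4 * (2 * (T - l)) ^ 2 -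
        3 * (2 * (T + l)) ^ 2 - 9684 / 10000 * (2 * T) ^ 2) / 4 := by
      simp only [F]
      field_simp
    linarith
  have hlim : Tendsto (fun T => ENNReal.ofReal (F T)) atTop (nhds (79 / 10000)) := by
    have e : (79 / 10000 : ℝ≥0∞) = ENNReal.ofReal (79 / 10000) := by
      rw [ENNReal.ofReal_div_of_pos (by norm_num)]
      norm_num
    rw [e]
    exact ENNReal.tendsto_ofReal hF
  rw [← hlim.liminf_eq]
  exact liminf_le_liminf hle
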